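/- Let $N$ and $a$ be integers with $1\le a\le N$. For positive integers $s_1,\dots,s_u$ put $$t^{\star}_{N,a}(s_1,\dots,s_u)=\sum_{k_1\ge\cdots\ge k_u\ge 0}\frac{1}{(Nk_1+a)^{s_1}\cdots(Nk_u+a)^{s_u}}.$$ For nonzero integers $s_1,\dots,s_u$ put $$\widetilde t_{N,a}(s_1,\dots,s_u)=\sum_{k_1>\cdots>k_u\ge 0}\frac{\operatorname{sign}(s_1)^{k_1}\cdots\operatorname{sign}(s_u)^{k_u}}{(Nk_1+a)^{|s_1|}\cdots(Nk_u+a)^{|s_u|}}\cdot\frac{(2a/N)_{k_u}}{k_u!},$$ where $(x)_m=x(x+1)\cdots(x+m-1)$ and $(x)_0=1$. For a real number $r$ put $$\widetilde t^{\,r}_{N,a}(s_1,\dots,s_u)=\sum_{\circ\,=\,\text{“}+\text{” or “},\text{”}} r^{\#\text{pluses}}\;\widetilde t_{N,a}(s_1\circ s_2\circ\cdots\circ s_u),$$ the sum running over all $2^{u-1}$ choices of the symbols $\circ$, where for nonzero integers $s,l$ the merged entry $s+l$ means $|s|+|l|$ if $sl>0$ and $-(|s|+|l|)$ if $sl<0$.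 Write $\overline{n}$ for an entry $-n$, write $\{2\}^{b}$ for the entry $2$ repeated $b$ times (no entry if $b=0$), and let $B(x,y)=\Gamma(x)\Gamma(y)/\Gamma(x+y)$ be the Beta function. Let $d,b_0\ge 1$ and $b_1,\dots,b_d\ge 0$ be integers. Then all the series defining the two sides below converge absolutely, and $$t^{\star}_{N,a}(\{2\}^{b_0},3,\{2\}^{b_1},\dots,3,\{2\}^{b_d})=\frac{2^{d+1}N}{B\left(\frac aN,\frac aN\right)}\;\widetilde t^{\,1/2}_{N,a}(\overline{2b_0+2},\,2b_1+3,\,\dots,\,2b_{d-1}+3,\,2b_d+2).$$ (For $d=1$ the index on the right is $(\overline{2b_0+2},\,2b_1+2)$.) -/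

import Mathlib

noncomputable section

namespace LevelT

/-- The factor `∏ i, 1 / (N * k i + a) ^ (s i)` for an index `s` and a list `k` of summation
variables of the same length. -/
def starTerm (N a : ℕ) (s k : List ℕ) : ℝ :=
  (List.zipWith (fun e m => 1 / ((N : ℝ) * (m : ℝ) + (a : ℝ)) ^ e) s k).prod

/-- The weakly decreasing lists `k₁ ≥ ⋯ ≥ k_u ≥ 0` of natural numbers. -/
abbrev WeakDec (u : ℕ) : Type :=
  {k : List ℕ // k.length = u ∧ k.Pairwise (fun x y => y ≤ x)}

/-- The strictly decreasing lists `k₁ > ⋯ > k_u ≥ 0` of natural numbers. -/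
abbrev StrictDec (u : ℕ) : Type :=
  {k : List ℕ // k.length = u ∧ k.Pairwise (fun x y => y < x)}

/-- The multiple `t`-star value of level `N`:
the sum over `k₁ ≥ ⋯ ≥ k_u ≥ 0` of `∏ i, 1 / (N * k i + a) ^ (s i)`. -/
def tStar (N a : ℕ) (s : List ℕ) : ℝ :=
  ∑' k : WeakDec s.length, starTerm N a s k.1

/-- The factor `(x)_m / m!`, where `(x)_m = x (x + 1) ⋯ (x + m - 1)` is the Pochhammer symbol. -/
def pochQuot (x : ℝ) (m : ℕ) : ℝ :=
  (ascPochhammer ℝ m).eval x / (m.factorial : ℝ)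

/-- The general term of the alternating multiple `t`-value: the product of the factors
`sign (s i) ^ (k i) / (N * k i + a) ^ |s i|`, times `(2 a / N)_{k_u} / k_u!` with `k_u` the last
summation variable. (For the empty list this is `1`.) -/
def altTerm (N a : ℕ) (s : List ℤ) (k : List ℕ) : ℝ :=
  (List.zipWith (fun (e : ℤ) (m : ℕ) =>
      (e.sign : ℝ) ^ m / ((N : ℝ) * (m : ℝ) + (a : ℝ)) ^ e.natAbs) s k).prod *
    pochQuot (2 * (a : ℝ) / (N : ℝ)) (k.getLastD 0)

/-- The alternating multiple `t`-value of level `N` containing factorial and Pochhammer symbols,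
a sum over `k₁ > ⋯ > k_u ≥ 0`. A negative entry `-n` of the index stands for `n` with a bar. -/
def tAlt (N a : ℕ) (s : List ℤ) : ℝ :=
  ∑' k : StrictDec s.length, altTerm N a s k.1

/-- The merged entry `x + y`: absolute values are added and signs are multiplied. -/
def plus (x y : ℤ) : ℤ :=
  if 0 < x * y then |x| + |y| else -(|x| + |y|)

/-- The index `s₁ ∘ s₂ ∘ ⋯ ∘ s_u`, where the `i`-th symbol `∘` is a plus if the `i`-th entry of
the second list is `true`, and a comma otherwise. -/
def combine : List ℤ → List Bool → List ℤ
  | x :: y :: l, true :: c => combine (plus x y :: l) c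
  | x :: y :: l, false :: c => x :: combine (y :: l) c
  | s, _ => s

/-- The interpolated alternating multiple `t`-value of level `N`: the sum of
`r ^ (number of pluses)` times the value at `s₁ ∘ ⋯ ∘ s_u`, over all `u - 1` choices of `∘`. -/
def tInterp (r : ℝ) (N a : ℕ) (s : List ℤ) : ℝ :=
  ∑ c : Fin (s.length - 1) → Bool,
    r ^ (Finset.univ.filter (fun i => c i = true)).card * tAlt N a (combine s (List.ofFn c))

/-- The index `({2}^{b 0}, 3, {2}^{b 1}, …, 3, {2}^{b d})`. -/
def twosThrees (d : ℕ) (b : ℕ → ℕ) : List ℕ :=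
  List.replicate (b 0) 2 ++
    (List.range d).flatMap (fun i => 3 :: List.replicate (b (i + 1)) 2)

/-- The index `(bar (2 b 0 + 2), 2 b 1 + 3, …, 2 b (d - 1) + 3, 2 b d + 2)`, for `d ≥ 1`. -/
def halfIndex (d : ℕ) (b : ℕ → ℕ) : List ℤ :=
  -(2 * (b 0 : ℤ) + 2) ::
    ((List.range (d - 1)).map (fun i => 2 * (b (i + 1) : ℤ) + 3) ++ [2 * (b d : ℤ) + 2])

end LevelT

end

/-!
Put `α = a / N` and `X k = N k + a`. The identity is the limit of an identity between finite sums.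

Let `A n k = Γ(n+1+α)² / ((n-k)! Γ(n+k+1+2α))` for `k ≤ n`, up to a constant (`kern`). From
`A (n+1) k * (X (n+1)² - X k²) = A n k * X (n+1)²` one sees that a function of `n` of the form
`∑ k ≤ n, A n k * f k` behaves like a truncated star sum: dividing `f k` by `X k²` amounts to
prefixing the entry `2` to the index (`Represents.two_cons`). The entry `3` is prefixed by
`Represents.three_cons`, which rests on the telescoping evaluation of the alternating tails
`∑ k > j, (-1)^k A n k` (`sum_kern_mul_half_add_sum`): this is where a new summation variable, with
weight `1/2` on the diagonal, is created. The empty index is represented by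
`2 N (-1)^k (2α)_k / (k! X k)` (`represents_nil`), because
`∑ k ≤ n, (-1)^k A n k (2α)_k / k! * X k` telescopes to zero for `n ≥ 1`. By induction on the depth
the truncated star sum at `({2}^{b 0}, 3, …, 3, {2}^{b d})` equals `2 ^ (d + 1) * N` times the
interpolated sum on the other side with the additional factor `A n k₁`, where `k₁` is the largest
variable (`represents_twosThrees`).

As `n → ∞`, Euler's product for the Gamma function gives `A n k → 1 / B(α, α)`, and `A n k` is
bounded uniformly in `n` and `k`, so dominated convergence applies (`Represents.tendsto`). The
series over decreasing lists are the limits of their truncations, and the sum over all choices of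
commas and pluses has the same recursive structure as the finite sums (`sum_combine_altHead`).
-/

open Finset Filter Topology

namespace LevelT

/-! ### The kernel of the finite identity -/

/-- The kernel `Γ(n+1+α)² / ((n-k)! Γ(n+k+1+2α))`, normalised so that no Gamma values occur: the
numerator is divided by `Γ(α)²` and the denominator by `Γ(2α)`. It vanishes for `k > n`. -/
noncomputable def kern (α : ℝ) (n k : ℕ) : ℝ :=
  if k ≤ n then
    (∏ j ∈ range (n + 1), (α + j) ^ 2) /
      (((n - k).factorial : ℝ) * ∏ j ∈ range (n + k + 1), (2 * α + j))
  else 0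

theorem kern_of_lt {α : ℝ} {n k : ℕ} (h : n < k) : kern α n k = 0 := by
  simp [kern, not_le.mpr h]

theorem prod_two_mul_add_pos {α : ℝ} (hα : 0 < α) (m : ℕ) :
    0 < ∏ j ∈ range m, (2 * α + (j : ℝ)) :=
  prod_pos fun j _ => by positivity

theorem kern_nonneg {α : ℝ} (hα : 0 < α) (n k : ℕ) : 0 ≤ kern α n k := by
  unfold kern
  split_ifs
  · have := prod_two_mul_add_pos hα (n + k + 1)
    have h2 : 0 ≤ ∏ j ∈ range (n + 1), (α + (j : ℝ)) ^ 2 := prod_nonneg fun j _ => by positivity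
    positivity
  · exact le_rfl

/-- The recursion in `n` that makes `∑ k, kern α n k * f k` behave like a star sum. -/
theorem kern_succ_left {α : ℝ} (hα : 0 < α) (n k : ℕ) (hk : k ≤ n + 1) :
    kern α (n + 1) k * (((n : ℝ) + 1 + α) ^ 2 - ((k : ℝ) + α) ^ 2) =
      kern α n k * ((n : ℝ) + 1 + α) ^ 2 := by
  rcases Nat.lt_or_ge n k with h | h
  · obtain rfl : k = n + 1 := by omega
    rw [kern_of_lt h]
    push_cast
    ring
  · obtain ⟨m, rfl⟩ := Nat.exists_eq_add_of_le h
    have h0 := (prod_two_mul_add_pos hα (k + m + k + 1)).ne'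
    have h1 : (2 * α + ((k + m + k + 1 : ℕ) : ℝ)) ≠ 0 := by positivity
    have h2 : ((m.factorial : ℕ) : ℝ) ≠ 0 := by positivity
    have h3 : ((m : ℝ) + 1) ≠ 0 := by positivity
    simp only [kern, if_pos hk, if_pos h]
    rw [show k + m + 1 - k = m + 1 by omega, show k + m - k = m by omega,
      show k + m + 1 + k + 1 = (k + m + k + 1) + 1 by ring, prod_range_succ _ (k + m + 1),
      prod_range_succ _ (k + m + k + 1), Nat.factorial_succ]
    push_cast at h1 ⊢
    field_simp
    ring

theorem kern_succ_right {α : ℝ} (hα : 0 < α) (n k : ℕ) (hk : k ≤ n) :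
    kern α n (k + 1) * ((n : ℝ) + k + 1 + 2 * α) = kern α n k * ((n : ℝ) - k) := by
  rcases hk.eq_or_lt with rfl | h
  · rw [kern_of_lt (Nat.lt_succ_self k)]
    ring
  · obtain ⟨m, rfl⟩ := Nat.exists_eq_add_of_lt h
    have h0 := (prod_two_mul_add_pos hα (k + m + 1 + k + 1)).ne'
    have h1 : (2 * α + ((k + m + 1 + k + 1 : ℕ) : ℝ)) ≠ 0 := by positivity
    have h2 : ((m.factorial : ℕ) : ℝ) ≠ 0 := by positivity
    have h3 : ((m : ℝ) + 1) ≠ 0 := by positivity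
    have h4 : k + 1 ≤ k + m + 1 := by omega
    simp only [kern, if_pos hk, if_pos h4]
    rw [show k + m + 1 - (k + 1) = m by omega, show k + m + 1 - k = m + 1 by omega,
      show k + m + 1 + (k + 1) + 1 = (k + m + 1 + k + 1) + 1 by ring,
      prod_range_succ _ (k + m + 1 + k + 1), Nat.factorial_succ]
    push_cast at h1 ⊢
    field_simp
    ring

theorem pochQuot_succ (x : ℝ) (k : ℕ) :
    pochQuot x (k + 1) * ((k : ℝ) + 1) = pochQuot x k * (x + k) := by
  have h2 : ((k.factorial : ℕ) : ℝ) ≠ 0 := by positivity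
  have h3 : ((k : ℝ) + 1) ≠ 0 := by positivity
  unfold pochQuot
  rw [ascPochhammer_succ_eval, Nat.factorial_succ]
  push_cast
  field_simp

/-- A telescoping sum: for `n ≥ 1` the truncated well-poised sum below vanishes at `m = n + 1`. -/
theorem sum_kern_mul_pochQuot {α : ℝ} (hα : 0 < α) (n m : ℕ) (hm : m ≤ n + 1) :
    2 * (n : ℝ) * ∑ k ∈ range m,
        kern α n k * ((-1) ^ k * pochQuot (2 * α) k * ((k : ℝ) + α)) =
      -((-1) ^ m * kern α n m * pochQuot (2 * α) m * (m * ((n : ℝ) + m + 2 * α))) := by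
  induction m with
  | zero => simp
  | succ m ih =>
    have hA := kern_succ_right hα n m (by omega)
    have hB := pochQuot_succ (2 * α) m
    rw [sum_range_succ, mul_add, ih (by omega), pow_succ]
    push_cast
    linear_combination
      (-((-1) ^ m) * pochQuot (2 * α) (m + 1) * ((m : ℝ) + 1)) * hA +
        (-((-1) ^ m) * kern α n m * ((n : ℝ) - m)) * hB

/-- The weights `1/2` on the diagonal and `1` below it pass through the alternating kernel sum. -/
theorem sum_kern_mul_half_add_sum {α : ℝ} (hα : 0 < α) (u : ℕ → ℝ) (n m : ℕ) (hm : m ≤ n + 1) :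
    ∑ k ∈ range m, kern α n k * ((-1) ^ k * (1 / 2 * u k + ∑ j ∈ range k, u j)) =
      1 / (2 * ((n : ℝ) + α)) * ∑ k ∈ range m, kern α n k * ((-1) ^ k * ((k + α) * u k)) -
        (-1) ^ m * kern α n m * (((m : ℝ) + n + 2 * α) / (2 * ((n : ℝ) + α))) *
          ∑ j ∈ range m, u j := by
  induction m with
  | zero => simp
  | succ m ih =>
    have hA := kern_succ_right hα n m (by omega)
    have h0 : (n : ℝ) + α ≠ 0 := by positivity
    rw [sum_range_succ, ih (by omega), sum_range_succ _ m, sum_range_succ _ m, pow_succ]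
    push_cast
    field_simp
    linear_combination (-((-1) ^ m) * (u m + ∑ j ∈ range m, u j)) * hA

/-! ### The finite identity -/

/-- The linear form `N k + a`. -/
noncomputable def lin (N a k : ℕ) : ℝ := (N : ℝ) * (k : ℝ) + (a : ℝ)

theorem lin_pos {N a : ℕ} (ha : 1 ≤ a) (k : ℕ) : 0 < lin N a k := by
  have : (0 : ℝ) < a := by exact_mod_cast ha
  unfold lin
  positivity

theorem lin_eq {N a : ℕ} (hN : 1 ≤ N) (k : ℕ) :
    lin N a k = N * ((k : ℝ) + (a : ℝ) / N) := by
  have : (N : ℝ) ≠ 0 := by positivity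
  unfold lin
  field_simp

/-- The star sum truncated to summation variables `< n`, by recursion on the index. -/
noncomputable def starSum (N a : ℕ) : List ℕ → ℕ → ℝ
  | [], _ => 1
  | e :: l, n => ∑ k ∈ range n, 1 / lin N a k ^ e * starSum N a l (k + 1)

/-- The truncated star sums at `l` are the sums of `f` against the kernel. The variables of
`starSum N a l (n + 1)` are at most `n`, as are the indices where `kern α n` is nonzero. -/
noncomputable def Represents (N a : ℕ) (l : List ℕ) (f : ℕ → ℝ) : Prop :=
  ∀ n, starSum N a l (n + 1) = ∑ k ∈ range (n + 1), kern ((a : ℝ) / N) n k * f k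

/-- Both sides satisfy the same first-order recursion in `n`. -/
theorem Represents.cons {N a : ℕ} (ha : 1 ≤ a) (hN : 1 ≤ N) (e : ℕ) (l : List ℕ) (f : ℕ → ℝ)
    (h : ∀ n, 1 / lin N a n ^ e * starSum N a l (n + 1) =
      1 / lin N a n ^ 2 * ∑ k ∈ range (n + 1),
        kern ((a : ℝ) / N) n k * (lin N a k ^ 2 * f k)) :
    Represents N a (e :: l) f := by
  have hα : (0 : ℝ) < (a : ℝ) / N := by
    have : (0 : ℝ) < a := by exact_mod_cast ha
    positivity
  have hN' : (N : ℝ) ≠ 0 := by positivity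
  intro n
  induction n with
  | zero =>
    have h0 := h 0
    have hx := (lin_pos (N := N) ha 0).ne'
    simp only [starSum, zero_add, sum_range_one] at h0 ⊢
    rw [h0]
    field_simp
  | succ n ih =>
    have h1 := h (n + 1)
    have hx := (lin_pos (N := N) ha (n + 1)).ne'
    change ∑ k ∈ range (n + 1 + 1), 1 / lin N a k ^ e * starSum N a l (k + 1) = _
    change ∑ k ∈ range (n + 1), 1 / lin N a k ^ e * starSum N a l (k + 1) = _ at ih
    rw [sum_range_succ, ih, h1, mul_sum]
    have : ∑ k ∈ range (n + 1), kern ((a : ℝ) / N) n k * f k =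
        ∑ k ∈ range (n + 1 + 1), kern ((a : ℝ) / N) n k * f k := by
      rw [sum_range_succ _ (n + 1), kern_of_lt (Nat.lt_succ_self n)]
      ring
    rw [this, ← sum_add_distrib]
    refine sum_congr rfl fun k hk => ?_
    have hk' := mem_range.mp hk
    have hR := kern_succ_left hα n k (by omega)
    rw [lin_eq hN] at hx ⊢
    rw [lin_eq hN]
    push_cast at hx ⊢
    have hx2 : ((n : ℝ) + 1 + (a : ℝ) / N) ≠ 0 := right_ne_zero_of_mul hx
    generalize (a : ℝ) / N = α at *
    field_simp
    linear_combination -f k * hR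

/-- An entry `2` only changes `f`, since the factor `1 / X n ^ 2` matches the one in the recursion
of the kernel. -/
theorem Represents.two_cons {N a : ℕ} (ha : 1 ≤ a) (hN : 1 ≤ N) {l : List ℕ} {f : ℕ → ℝ}
    (h : Represents N a l f) : Represents N a (2 :: l) (fun k => f k / lin N a k ^ 2) := by
  refine Represents.cons ha hN _ _ _ fun n => ?_
  rw [h n]
  congr 1
  refine sum_congr rfl fun k _ => ?_
  have hx := (lin_pos (N := N) ha k).ne'
  field_simp

theorem Represents.replicate_append {N a : ℕ} (ha : 1 ≤ a) (hN : 1 ≤ N) {l : List ℕ} {f : ℕ → ℝ}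
    (h : Represents N a l f) (m : ℕ) :
    Represents N a (List.replicate m 2 ++ l) (fun k => f k / lin N a k ^ (2 * m)) := by
  induction m with
  | zero => simpa using h
  | succ m ih =>
    have := ih.two_cons ha hN
    simp only [div_div, ← pow_add] at this
    exact this

/-- An entry `3` contributes a factor `1 / X n` beyond the recursion of the kernel; this factor
turns the values `u` into their half-weighted partial sums. -/
theorem Represents.three_cons {N a : ℕ} (ha : 1 ≤ a) (hN : 1 ≤ N) {l : List ℕ} {c : ℝ}
    {u : ℕ → ℝ} (h : Represents N a l (fun k => c * ((-1) ^ k * (lin N a k * u k)))) :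
    Represents N a (3 :: l) (fun k => 2 * c * ((-1) ^ k *
      ((1 / 2 * u k + ∑ j ∈ range k, u j) / lin N a k ^ 2))) := by
  have hα : (0 : ℝ) < (a : ℝ) / N := by
    have : (0 : ℝ) < a := by exact_mod_cast ha
    positivity
  have hN' : (N : ℝ) ≠ 0 := by positivity
  refine Represents.cons ha hN _ _ _ fun n => ?_
  have h1 := sum_kern_mul_half_add_sum hα u n (n + 1) le_rfl
  rw [kern_of_lt (Nat.lt_succ_self n), mul_zero, zero_mul, zero_mul, sub_zero] at h1
  have h2 : ∑ k ∈ range (n + 1), kern ((a : ℝ) / N) n k * (lin N a k ^ 2 * (2 * c * ((-1) ^ k *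
      ((1 / 2 * u k + ∑ j ∈ range k, u j) / lin N a k ^ 2)))) =
      2 * c * ∑ k ∈ range (n + 1),
        kern ((a : ℝ) / N) n k * ((-1) ^ k * (1 / 2 * u k + ∑ j ∈ range k, u j)) := by
    rw [mul_sum]
    refine sum_congr rfl fun k _ => ?_
    have hx := (lin_pos (N := N) ha k).ne'
    field_simp
  have h3 : ∑ k ∈ range (n + 1), kern ((a : ℝ) / N) n k * (c * ((-1) ^ k * (lin N a k * u k))) =
      c * N * ∑ k ∈ range (n + 1),
        kern ((a : ℝ) / N) n k * ((-1) ^ k * (((k : ℝ) + (a : ℝ) / N) * u k)) := by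
    rw [mul_sum]
    refine sum_congr rfl fun k _ => ?_
    rw [lin_eq hN]
    ring
  have hx : (n : ℝ) + (a : ℝ) / N ≠ 0 := by positivity
  rw [h n, h2, h3, h1, lin_eq hN]
  field_simp

/-- A terminating case of Dixon's well-poised summation. -/
theorem represents_nil {N a : ℕ} (ha : 1 ≤ a) (hN : 1 ≤ N) :
    Represents N a [] (fun k => 2 * N * ((-1) ^ k *
      (pochQuot (2 * a / N) k / lin N a k))) := by
  have ha' : (0 : ℝ) < a := by exact_mod_cast ha
  have hα : (0 : ℝ) < (a : ℝ) / N := by positivity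
  have hN' : (N : ℝ) ≠ 0 := by positivity
  -- The difference of consecutive sums is a multiple of the telescoping sum, hence zero.
  have key : ∀ n, ∑ k ∈ range (n + 1 + 1), kern ((a : ℝ) / N) (n + 1) k * (2 * N * ((-1) ^ k *
      (pochQuot (2 * a / N) k / lin N a k))) =
      ∑ k ∈ range (n + 1), kern ((a : ℝ) / N) n k * (2 * N * ((-1) ^ k *
      (pochQuot (2 * a / N) k / lin N a k))) := by
    intro n
    have h1 := sum_kern_mul_pochQuot hα (n + 1) (n + 1 + 1) le_rfl
    rw [kern_of_lt (Nat.lt_succ_self (n + 1)), mul_zero, zero_mul, zero_mul, neg_zero] at h1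
    have h2 : (2 : ℝ) * ((n + 1 : ℕ) : ℝ) ≠ 0 := by positivity
    have h3 := (mul_eq_zero.mp h1).resolve_left h2
    have hext : ∑ k ∈ range (n + 1), kern ((a : ℝ) / N) n k * (2 * N * ((-1) ^ k *
        (pochQuot (2 * a / N) k / lin N a k))) =
        ∑ k ∈ range (n + 1 + 1), kern ((a : ℝ) / N) n k * (2 * N * ((-1) ^ k *
        (pochQuot (2 * a / N) k / lin N a k))) := by
      rw [sum_range_succ _ (n + 1), kern_of_lt (Nat.lt_succ_self n)]
      ring
    rw [hext, ← sub_eq_zero, ← sum_sub_distrib]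
    have hx : ((n : ℝ) + 1 + (a : ℝ) / N) ≠ 0 := by positivity
    refine Eq.trans ?_ ((congrArg (2 / ((n : ℝ) + 1 + (a : ℝ) / N) ^ 2 * ·) h3).trans (mul_zero _))
    rw [mul_sum]
    refine sum_congr rfl fun k hk => ?_
    have hR := kern_succ_left hα n k (by have := mem_range.mp hk; omega)
    have hxk : ((k : ℝ) + (a : ℝ) / N) ≠ 0 := by positivity
    rw [lin_eq hN, show (2 : ℝ) * a / N = 2 * (a / N) by ring]
    generalize (a : ℝ) / N = α at *
    field_simp
    linear_combination (pochQuot (2 * α) k) * hR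
  intro n
  induction n with
  | zero =>
    simp [starSum, kern, pochQuot, lin]
    field_simp
  | succ n ih => rw [key, ← ih]; rfl

/-- The weight of the entry `e` at the summation variable `k`. -/
noncomputable def altWeight (N a : ℕ) (e : ℤ) (k : ℕ) : ℝ :=
  (e.sign : ℝ) ^ k / lin N a k ^ e.natAbs

/-- The `r`-interpolated sums over the variables belonging to the entries of `l`, all of them
bounded by `k`. A variable equal to its predecessor has the weight `r`, a smaller one the
weight `1`. -/
noncomputable def interpSum (r : ℝ) (N a : ℕ) : List ℤ → ℕ → ℝ
  | [], k => pochQuot (2 * a / N) k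
  | e :: l, k => r * (altWeight N a e k * interpSum r N a l k) +
      ∑ j ∈ range k, altWeight N a e j * interpSum r N a l j

theorem altWeight_of_pos (N a : ℕ) (n : ℕ) (hn : 0 < n) (k : ℕ) :
    altWeight N a (n : ℤ) k = 1 / lin N a k ^ n := by
  simp [altWeight, Int.sign_natCast_of_ne_zero hn.ne']

theorem twosThrees_succ (d : ℕ) (b : ℕ → ℕ) :
    twosThrees (d + 1) b =
      List.replicate (b 0) 2 ++ 3 :: twosThrees d (fun i => b (i + 1)) := by
  simp [twosThrees, List.range_succ_eq_map, List.flatMap_map]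

/-- The entries of the interpolated index after the barred one. -/
noncomputable def halfTail (d : ℕ) (b : ℕ → ℕ) : List ℤ :=
  (List.range (d - 1)).map (fun i => 2 * (b (i + 1) : ℤ) + 3) ++ [2 * (b d : ℤ) + 2]

theorem halfTail_succ_succ (d : ℕ) (b : ℕ → ℕ) :
    halfTail (d + 1 + 1) b =
      ((2 * b 1 + 3 : ℕ) : ℤ) :: halfTail (d + 1) (fun i => b (i + 1)) := by
  simp [halfTail, List.range_succ_eq_map]

/-- Prefixing `{2}^m, 3` to the index prefixes one entry to the index of the interpolated sums. -/
theorem Represents.replicate_append_three_cons {N a : ℕ} (ha : 1 ≤ a) (hN : 1 ≤ N) (m : ℕ)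
    {l : List ℕ} {e : ℤ} {t : List ℤ} {c : ℝ}
    (h : Represents N a l (fun k => c * ((-1) ^ k *
      (lin N a k * (altWeight N a e k * interpSum (1 / 2) N a t k))))) :
    Represents N a (List.replicate m 2 ++ 3 :: l) (fun k => 2 * c * ((-1) ^ k *
      (interpSum (1 / 2) N a (e :: t) k / lin N a k ^ (2 * m + 2)))) := by
  convert (Represents.three_cons ha hN h).replicate_append ha hN m using 2 with k
  rw [interpSum]
  have hx := (lin_pos (N := N) ha k).ne'
  field_simp
  ring

/-- The finite form of the identity, at depth `d + 1`. -/
theorem represents_twosThrees {N a : ℕ} (ha : 1 ≤ a) (hN : 1 ≤ N) (d : ℕ) (b : ℕ → ℕ) :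
    Represents N a (twosThrees (d + 1) b) (fun k => 2 ^ (d + 2) * N * ((-1) ^ k *
      (interpSum (1 / 2) N a (halfTail (d + 1) b) k / lin N a k ^ (2 * b 0 + 2)))) := by
  induction d generalizing b with
  | zero =>
    have h1 := (represents_nil ha hN).replicate_append ha hN (b 1)
    have := Represents.replicate_append_three_cons ha hN (b 0) (l := List.replicate (b 1) 2 ++ [])
      (e := ((2 * b 1 + 2 : ℕ) : ℤ)) (t := []) (c := 2 * N) (by
      convert h1 using 2 with k
      have hx := (lin_pos (N := N) ha k).ne'
      rw [altWeight_of_pos _ _ _ (by omega), interpSum]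
      field_simp
      ring)
    rw [twosThrees_succ]
    convert this using 2 with k
    · simp [twosThrees]
    · have : halfTail (0 + 1) b = [((2 * b 1 + 2 : ℕ) : ℤ)] := by simp [halfTail]
      rw [this]
      ring
  | succ d ih =>
    have h1 := ih (fun i => b (i + 1))
    have := Represents.replicate_append_three_cons ha hN (b 0)
      (l := twosThrees (d + 1) (fun i => b (i + 1))) (e := ((2 * b 1 + 3 : ℕ) : ℤ))
      (t := halfTail (d + 1) (fun i => b (i + 1))) (c := 2 ^ (d + 2) * N) (by
      convert h1 using 2 with k
      have hx := (lin_pos (N := N) ha k).ne'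
      rw [altWeight_of_pos _ _ _ (by omega), zero_add]
      field_simp
      ring)
    rw [twosThrees_succ, halfTail_succ_succ]
    convert this using 2 with k
    ring

/-! ### The limit of the kernel -/

theorem kern_zero_eq {α : ℝ} (n : ℕ) (hn : n ≠ 0) :
    kern α n 0 = Real.GammaSeq (2 * α) n / Real.GammaSeq α n ^ 2 := by
  have h1 : ((n.factorial : ℕ) : ℝ) ≠ 0 := by positivity
  have h2 : (n : ℝ) ^ α ≠ 0 := by positivity
  have h3 : (n : ℝ) ^ (2 * α) = ((n : ℝ) ^ α) ^ 2 := by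
    rw [mul_comm, Real.rpow_mul (by positivity)]
    norm_cast
  rw [kern, if_pos (Nat.zero_le n), Real.GammaSeq, Real.GammaSeq, h3, prod_pow]
  simp only [Nat.sub_zero, add_zero]
  field_simp

theorem tendsto_kern {α : ℝ} (hα : 0 < α) (k : ℕ) :
    Tendsto (fun n => kern α n k) atTop (𝓝 (1 / ProbabilityTheory.beta α α)) := by
  induction k with
  | zero =>
    have h1 := (Real.GammaSeq_tendsto_Gamma (2 * α)).div
      ((Real.GammaSeq_tendsto_Gamma α).pow 2) (pow_ne_zero _ (Real.Gamma_pos_of_pos hα).ne')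
    have h2 : Real.Gamma (2 * α) / Real.Gamma α ^ 2 = 1 / ProbabilityTheory.beta α α := by
      rw [ProbabilityTheory.beta, ← two_mul, one_div_div, sq]
    rw [h2] at h1
    refine h1.congr' ?_
    filter_upwards [eventually_ne_atTop 0] with n hn
    exact (kern_zero_eq n hn).symm
  | succ k ih =>
    have hr : Tendsto (fun n : ℕ => ((n : ℝ) - k) / ((n : ℝ) + k + 1 + 2 * α)) atTop (𝓝 1) := by
      have h0 : Tendsto (fun n : ℕ => (n : ℝ) + (k + 1 + 2 * α)) atTop atTop :=
        tendsto_atTop_add_const_right _ _ tendsto_natCast_atTop_atTop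
      have h1 := (tendsto_const_nhds (x := (1 : ℝ))).sub
        (h0.const_div_atTop (2 * k + 1 + 2 * α))
      rw [sub_zero] at h1
      refine h1.congr fun n => ?_
      have : (n : ℝ) + (k + 1 + 2 * α) ≠ 0 := by positivity
      have : (n : ℝ) + k + 1 + 2 * α ≠ 0 := by positivity
      field_simp
      ring
    have h1 := ih.mul hr
    rw [mul_one] at h1
    refine h1.congr' ?_
    filter_upwards [eventually_ge_atTop k] with n hn
    have h2 := kern_succ_right hα n k hn
    have : (n : ℝ) + k + 1 + 2 * α ≠ 0 := by positivity
    rw [mul_div_assoc', ← h2]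
    field_simp

theorem kern_le_kern_zero {α : ℝ} (hα : 0 < α) (n k : ℕ) : kern α n k ≤ kern α n 0 := by
  induction k with
  | zero => exact le_rfl
  | succ k ih =>
    rcases Nat.lt_or_ge n k with h | h
    · rw [kern_of_lt (by omega)]
      exact kern_nonneg hα n 0
    · refine le_trans ?_ ih
      have h2 := kern_succ_right hα n k h
      have hp : 0 < (n : ℝ) + k + 1 + 2 * α := by positivity
      refine le_of_mul_le_mul_right ?_ hp
      rw [h2]
      refine mul_le_mul_of_nonneg_left ?_ (kern_nonneg hα n k)
      have : (0 : ℝ) ≤ k := by positivity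
      linarith

theorem exists_kern_le {α : ℝ} (hα : 0 < α) : ∃ C, ∀ n k, kern α n k ≤ C := by
  obtain ⟨C, hC⟩ := (tendsto_kern hα 0).bddAbove_range
  exact ⟨C, fun n k => (kern_le_kern_zero hα n k).trans (hC ⟨n, rfl⟩)⟩

/-- Passage to the limit in a representation through the kernel. -/
theorem Represents.tendsto {N a : ℕ} (ha : 1 ≤ a) (hN : 1 ≤ N) {l : List ℕ} {f : ℕ → ℝ}
    (h : Represents N a l f) (hf : Summable f) :
    Tendsto (starSum N a l) atTop
      (𝓝 (1 / ProbabilityTheory.beta ((a : ℝ) / N) ((a : ℝ) / N) * ∑' k, f k)) := by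
  have hα : (0 : ℝ) < (a : ℝ) / N := by
    have : (0 : ℝ) < a := by exact_mod_cast ha
    positivity
  obtain ⟨C, hC⟩ := exists_kern_le hα
  rw [← tendsto_add_atTop_iff_nat 1, ← tsum_mul_left]
  have key := tendsto_tsum_of_dominated_convergence (𝓕 := atTop)
    (f := fun n k => kern ((a : ℝ) / N) n k * f k) (hf.abs.mul_left C)
    (fun k => (tendsto_kern hα k).mul_const (f k))
    (Eventually.of_forall fun n k => by
      rw [norm_mul, Real.norm_eq_abs, Real.norm_eq_abs, abs_of_nonneg (kern_nonneg hα n k)]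
      exact mul_le_mul_of_nonneg_right (hC n k) (abs_nonneg _))
  refine key.congr fun n => ?_
  rw [h n]
  refine tsum_eq_sum fun k hk => ?_
  rw [kern_of_lt (by simpa using hk), zero_mul]

/-! ### Sums over decreasing lists -/

/-- The lists of length `u` with entries `< n`, each entry being less than its predecessor
plus `δ`: strictly decreasing lists for `δ = 0`, weakly decreasing ones for `δ = 1`. -/
def decLists (δ : ℕ) : ℕ → ℕ → Finset (List ℕ)
  | 0, _ => {[]}
  | u + 1, n => (range n).biUnion fun k =>
      (decLists δ u (k + δ)).map ⟨List.cons k, List.cons_injective⟩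

theorem mem_decLists {δ : ℕ} (hδ : δ ≤ 1) (u n : ℕ) (l : List ℕ) :
    l ∈ decLists δ u n ↔
      (l.length = u ∧ l.Pairwise (fun x y => y < x + δ)) ∧ ∀ x ∈ l, x < n := by
  induction u generalizing n l with
  | zero =>
    simp only [decLists, mem_singleton, List.length_eq_zero_iff]
    constructor
    · rintro rfl
      simp
    · exact fun h => h.1.1
  | succ u ih =>
    simp only [decLists, mem_biUnion, mem_range, Finset.mem_map, Function.Embedding.coeFn_mk, ih]
    constructor
    · rintro ⟨k, hk, l, ⟨⟨rfl, hp⟩, hl⟩, rfl⟩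
      refine ⟨⟨rfl, List.pairwise_cons.mpr ⟨hl, hp⟩⟩, ?_⟩
      intro x hx
      rcases List.mem_cons.mp hx with rfl | hx
      · exact hk
      · have := hl x hx
        omega
    · rintro ⟨⟨hl, hp⟩, hn⟩
      cases l with
      | nil => simp at hl
      | cons k l =>
        rw [List.pairwise_cons] at hp
        exact ⟨k, hn k (by simp), l, ⟨⟨by simpa using hl, hp.2⟩, hp.1⟩, rfl⟩

theorem sum_decLists_succ (δ u n : ℕ) (f : List ℕ → ℝ) :
    ∑ l ∈ decLists δ (u + 1) n, f l =
      ∑ k ∈ range n, ∑ l ∈ decLists δ u (k + δ), f (k :: l) := by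
  rw [decLists, sum_biUnion]
  · simp
  · intro i _ j _ hij
    rw [Function.onFun, disjoint_left]
    simp only [Finset.mem_map, Function.Embedding.coeFn_mk, not_exists, not_and]
    rintro _ ⟨l, _, rfl⟩ l' _ h
    exact hij (List.cons_eq_cons.mp h).1.symm

open Classical in
theorem tendsto_decLists {δ : ℕ} (hδ : δ ≤ 1) (u : ℕ) {p : List ℕ → Prop}
    (hp : ∀ l, p l ↔ l.length = u ∧ l.Pairwise (fun x y => y < x + δ)) :
    Tendsto (fun n => (decLists δ u n).subtype p) atTop atTop := by
  refine tendsto_atTop_finset_of_monotone ?_ ?_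
  · intro m n hmn l
    simp only [mem_subtype, mem_decLists hδ]
    exact fun h => ⟨h.1, fun x hx => (h.2 x hx).trans_le hmn⟩
  · intro l
    -- Every entry of a list of natural numbers is at most the sum of the list.
    refine ⟨l.1.sum + 1, ?_⟩
    simp only [mem_subtype, mem_decLists hδ]
    exact ⟨(hp _).mp l.2, fun x hx => Nat.lt_succ_of_le (List.le_sum_of_mem hx)⟩

/-- A family on decreasing lists is summable if its truncated absolute sums are bounded. -/
theorem summable_of_sum_decLists_le {δ : ℕ} (hδ : δ ≤ 1) (u : ℕ) {p : List ℕ → Prop}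
    (hp : ∀ l, p l ↔ l.length = u ∧ l.Pairwise (fun x y => y < x + δ)) (f : List ℕ → ℝ) (C : ℝ)
    (hC : ∀ n, ∑ l ∈ decLists δ u n, |f l| ≤ C) : Summable (fun l : {l // p l} => f l.1) := by
  classical
  refine Summable.of_abs (summable_of_sum_le (c := C) (fun _ => abs_nonneg _) fun t => ?_)
  obtain ⟨n, hn⟩ := ((tendsto_decLists hδ u hp).eventually_ge_atTop t).exists
  refine (sum_le_sum_of_subset_of_nonneg hn fun _ _ _ => abs_nonneg _).trans ?_
  refine le_trans (le_of_eq ?_) (hC n)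
  exact sum_subtype_of_mem (fun l => |f l|) fun l hl => (hp l).mpr ((mem_decLists hδ u n l).mp hl).1

theorem Summable.tendsto_sum_decLists {δ : ℕ} (hδ : δ ≤ 1) (u : ℕ) {p : List ℕ → Prop}
    (hp : ∀ l, p l ↔ l.length = u ∧ l.Pairwise (fun x y => y < x + δ)) {f : List ℕ → ℝ}
    (hf : Summable (fun l : {l // p l} => f l.1)) :
    Tendsto (fun n => ∑ l ∈ decLists δ u n, f l) atTop (𝓝 (∑' l : {l // p l}, f l.1)) := by
  classical
  refine (hf.hasSum.comp (tendsto_decLists hδ u hp)).congr fun n => ?_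
  exact sum_subtype_of_mem f fun l hl => (hp l).mpr ((mem_decLists hδ u n l).mp hl).1

theorem weakDec_iff (u : ℕ) (l : List ℕ) :
    (l.length = u ∧ l.Pairwise (fun x y => y ≤ x)) ↔
      l.length = u ∧ l.Pairwise (fun x y => y < x + 1) := by
  simp only [Nat.lt_succ_iff]

theorem strictDec_iff (u : ℕ) (l : List ℕ) :
    (l.length = u ∧ l.Pairwise (fun x y => y < x)) ↔
      l.length = u ∧ l.Pairwise (fun x y => y < x + 0) := Iff.rfl

/-! ### The star series -/

theorem sum_starTerm (N a : ℕ) (s : List ℕ) (n : ℕ) :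
    ∑ k ∈ decLists 1 s.length n, starTerm N a s k = starSum N a s n := by
  induction s generalizing n with
  | nil => simp [decLists, starTerm, starSum]
  | cons e s ih =>
    rw [List.length_cons, sum_decLists_succ, starSum]
    refine sum_congr rfl fun k _ => ?_
    rw [← ih, mul_sum]
    rfl

theorem starTerm_nonneg (N a : ℕ) (s k : List ℕ) : 0 ≤ starTerm N a s k := by
  induction s generalizing k with
  | nil => simp [starTerm]
  | cons e s ih =>
    cases k with
    | nil => simp [starTerm]
    | cons m k =>
      change 0 ≤ 1 / ((N : ℝ) * (m : ℝ) + (a : ℝ)) ^ e * starTerm N a s k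
      exact mul_nonneg (by positivity) (ih k)

theorem summable_starTerm_of_tendsto {N a : ℕ} {s : List ℕ} {L : ℝ}
    (h : Tendsto (starSum N a s) atTop (𝓝 L)) :
    Summable (fun k : WeakDec s.length => starTerm N a s k.1) := by
  obtain ⟨C, hC⟩ := h.bddAbove_range
  refine summable_of_sum_decLists_le le_rfl s.length (weakDec_iff s.length) (starTerm N a s) C
    fun n => ?_
  simp only [abs_of_nonneg (starTerm_nonneg N a s _), sum_starTerm]
  exact hC ⟨n, rfl⟩

theorem tStar_eq_of_tendsto {N a : ℕ} {s : List ℕ} {L : ℝ}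
    (h : Tendsto (starSum N a s) atTop (𝓝 L)) : tStar N a s = L := by
  have h1 := Summable.tendsto_sum_decLists le_rfl s.length (weakDec_iff s.length)
    (summable_starTerm_of_tendsto h)
  simp only [sum_starTerm] at h1
  exact tendsto_nhds_unique h1 h

/-! ### The alternating series -/

/-- The sum over the strictly decreasing variables `< k` belonging to the entries of `l`, which
follow a variable equal to `k`. -/
noncomputable def altSum (N a : ℕ) : List ℤ → ℕ → ℝ
  | [], k => pochQuot (2 * a / N) k
  | e :: l, k => ∑ j ∈ range k, altWeight N a e j * altSum N a l j

/-- The part of the alternating series whose largest variable is `k`. -/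
noncomputable def altHead (N a : ℕ) : List ℤ → ℕ → ℝ
  | [], _ => 0
  | e :: l, k => altWeight N a e k * altSum N a l k

theorem altTerm_cons (N a : ℕ) (e : ℤ) (s : List ℤ) (m : ℕ) (k : List ℕ) :
    altTerm N a (e :: s) (m :: k) = altWeight N a e m *
      ((List.zipWith (fun (e : ℤ) (m : ℕ) => altWeight N a e m) s k).prod *
        pochQuot (2 * a / N) (k.getLastD m)) := by
  rw [altTerm, List.getLastD_cons, List.zipWith_cons_cons, List.prod_cons, mul_assoc]
  rfl

theorem sum_zipWith_altWeight (N a : ℕ) (s : List ℤ) (m : ℕ) :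
    ∑ k ∈ decLists 0 s.length m,
      (List.zipWith (fun (e : ℤ) (m : ℕ) => altWeight N a e m) s k).prod *
        pochQuot (2 * a / N) (k.getLastD m) = altSum N a s m := by
  induction s generalizing m with
  | nil => simp [decLists, altSum]
  | cons e s ih =>
    rw [List.length_cons, sum_decLists_succ, altSum]
    refine sum_congr rfl fun k _ => ?_
    rw [← ih, mul_sum]
    refine sum_congr rfl fun l _ => ?_
    rw [List.getLastD_cons, List.zipWith_cons_cons, List.prod_cons, mul_assoc]

theorem sum_altTerm (N a : ℕ) (s : List ℤ) (hs : s ≠ []) (n : ℕ) :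
    ∑ k ∈ decLists 0 s.length n, altTerm N a s k = ∑ k ∈ range n, altHead N a s k := by
  cases s with
  | nil => exact absurd rfl hs
  | cons e s =>
    rw [List.length_cons, sum_decLists_succ]
    refine sum_congr rfl fun k _ => ?_
    simp only [altTerm_cons]
    rw [← mul_sum, add_zero, sum_zipWith_altWeight, altHead]

/-! ### Absolute convergence -/

theorem pochQuot_nonneg {x : ℝ} (hx : 0 ≤ x) (k : ℕ) : 0 ≤ pochQuot x k := by
  induction k with
  | zero => simp [pochQuot]
  | succ k ih =>
    have h := pochQuot_succ x k
    have h1 : (0 : ℝ) < k + 1 := by positivity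
    refine nonneg_of_mul_nonneg_left ?_ h1
    rw [h]
    positivity

theorem pochQuot_le {x : ℝ} (hx : 0 ≤ x) (hx2 : x ≤ 2) (k : ℕ) : pochQuot x k ≤ k + 1 := by
  induction k with
  | zero => simp [pochQuot]
  | succ k ih =>
    have h := pochQuot_succ x k
    have h1 : (0 : ℝ) < k + 1 := by positivity
    refine le_of_mul_le_mul_right ?_ h1
    rw [h]
    push_cast
    calc pochQuot x k * (x + k) ≤ (k + 1) * (2 + k) := by gcongr
      _ = _ := by ring

theorem altWeight_abs {N a : ℕ} {e : ℤ} (he : e ≠ 0) (k : ℕ) :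
    altWeight N a |e| k = |altWeight N a e k| := by
  have h1 : |(e.sign : ℝ)| = 1 := by
    exact_mod_cast Int.abs_sign_of_ne_zero he
  have h2 : (|e|).sign = 1 := Int.sign_eq_one_of_pos (abs_pos.mpr he)
  have h3 : 0 ≤ lin N a k := by unfold lin; positivity
  rw [altWeight, altWeight, h2, Int.natAbs_abs, abs_div, abs_pow, abs_pow, h1, abs_of_nonneg h3]
  simp

theorem abs_altWeight_le {N a : ℕ} (ha : 1 ≤ a) (hN : 1 ≤ N) {e : ℤ} {m : ℕ} (hm : 1 ≤ m)
    (he : m ≤ e.natAbs) (k : ℕ) : |altWeight N a e k| ≤ 1 / ((k : ℝ) + 1) ^ m := by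
  have h1 : |(e.sign : ℝ)| = 1 := by
    exact_mod_cast Int.abs_sign_of_ne_zero (by omega : e ≠ 0)
  have h3 : (k : ℝ) + 1 ≤ lin N a k := by
    have h4 : (1 : ℝ) ≤ a := by exact_mod_cast ha
    have h5 : (1 : ℝ) ≤ N := by exact_mod_cast hN
    unfold lin
    nlinarith [(Nat.cast_nonneg k : (0 : ℝ) ≤ k)]
  have h6 : (1 : ℝ) ≤ (k : ℝ) + 1 := by
    have : (0 : ℝ) ≤ k := by positivity
    linarith
  rw [altWeight, abs_div, abs_pow, abs_pow, h1, abs_of_pos (lin_pos ha k), one_pow]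
  refine one_div_le_one_div_of_le (by positivity) ?_
  calc ((k : ℝ) + 1) ^ m ≤ ((k : ℝ) + 1) ^ e.natAbs := pow_le_pow_right₀ h6 he
    _ ≤ _ := by gcongr

/-- Making all signs positive turns the terms into their absolute values, so that the truncated
sums of absolute values are again sums of the same kind. -/
theorem abs_altTerm {N a : ℕ} (s : List ℤ) (hs : ∀ e ∈ s, e ≠ 0) (k : List ℕ) :
    |altTerm N a s k| = altTerm N a (s.map abs) k := by
  have h0 : 0 ≤ pochQuot (2 * (a : ℝ) / (N : ℝ)) (k.getLastD 0) :=
    pochQuot_nonneg (by positivity) _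
  rw [altTerm, altTerm, abs_mul, abs_of_nonneg h0]
  congr 1
  change |(List.zipWith (fun (e : ℤ) (m : ℕ) => altWeight N a e m) s k).prod| =
    (List.zipWith (fun (e : ℤ) (m : ℕ) => altWeight N a e m) (s.map abs) k).prod
  clear h0
  induction s generalizing k with
  | nil => simp
  | cons e s ih =>
    cases k with
    | nil => simp
    | cons m k =>
      rw [List.map_cons, List.zipWith_cons_cons, List.zipWith_cons_cons, List.prod_cons,
        List.prod_cons, abs_mul, ih (fun x hx => hs x (List.mem_cons_of_mem _ hx)),
        altWeight_abs (hs e List.mem_cons_self)]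

theorem abs_altSum_le {N a : ℕ} (ha : 1 ≤ a) (haN : a ≤ N) (l : List ℤ)
    (hl : ∀ e ∈ l, 2 ≤ e.natAbs) (k : ℕ) : |altSum N a l k| ≤ k + 1 := by
  induction l generalizing k with
  | nil =>
    have hx : (0 : ℝ) ≤ 2 * a / N := by positivity
    have h1 : (0 : ℝ) < N := by exact_mod_cast (by omega : 0 < N)
    have h2 : (a : ℝ) ≤ N := by exact_mod_cast haN
    rw [altSum, abs_of_nonneg (pochQuot_nonneg hx k)]
    refine pochQuot_le hx ?_ k
    rw [div_le_iff₀ h1]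
    linarith
  | cons e l ih =>
    rw [altSum]
    calc |∑ j ∈ range k, altWeight N a e j * altSum N a l j|
        ≤ ∑ j ∈ range k, |altWeight N a e j * altSum N a l j| := abs_sum_le_sum_abs _ _
      _ ≤ ∑ j ∈ range k, (1 : ℝ) := by
          refine sum_le_sum fun j _ => ?_
          have h1 := abs_altWeight_le ha (ha.trans haN) (by norm_num)
            (hl e List.mem_cons_self) j
          have h2 := ih (fun x hx => hl x (List.mem_cons_of_mem _ hx)) j
          have h3 : (1 : ℝ) ≤ (j : ℝ) + 1 := by
            have : (0 : ℝ) ≤ j := by positivity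
            linarith
          rw [abs_mul]
          calc _ ≤ 1 / ((j : ℝ) + 1) ^ 2 * (j + 1) := by gcongr
            _ = 1 / ((j : ℝ) + 1) := by field_simp
            _ ≤ 1 := by rw [div_le_one (by positivity)]; exact h3
      _ ≤ k + 1 := by simp

/-- Growth conditions on an index that guarantee absolute convergence: the factor `(2α)_k / k!` is
at most `k + 1`, hence so are the inner sums, and an outer exponent `≥ 4` makes up for this. -/
def IsAdmissible (s : List ℤ) : Prop :=
  ∃ e l, s = e :: l ∧ 4 ≤ e.natAbs ∧ ∀ x ∈ l, 2 ≤ x.natAbs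

theorem IsAdmissible.map_abs {s : List ℤ} (h : IsAdmissible s) : IsAdmissible (s.map abs) := by
  obtain ⟨e, l, rfl, he, hl⟩ := h
  refine ⟨|e|, l.map abs, rfl, by rwa [Int.natAbs_abs], ?_⟩
  simpa [Int.natAbs_abs] using hl

theorem IsAdmissible.abs_altHead_le {N a : ℕ} (ha : 1 ≤ a) (haN : a ≤ N) {s : List ℤ}
    (h : IsAdmissible s) (k : ℕ) : |altHead N a s k| ≤ 1 / ((k : ℝ) + 1) ^ 2 := by
  obtain ⟨e, l, rfl, he, hl⟩ := h
  have h1 := abs_altWeight_le ha (ha.trans haN) (m := 3) (by norm_num) (by omega : 3 ≤ e.natAbs) k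
  rw [altHead, abs_mul]
  calc _ ≤ 1 / ((k : ℝ) + 1) ^ 3 * (k + 1) := by
        have := abs_altSum_le ha haN l hl k
        gcongr
    _ = _ := by field_simp

theorem summable_one_div_succ_sq : Summable (fun k : ℕ => 1 / ((k : ℝ) + 1) ^ 2) := by
  have := (summable_nat_add_iff 1).mpr (Real.summable_one_div_nat_pow.mpr one_lt_two)
  simpa using this

theorem IsAdmissible.summable_altHead {N a : ℕ} (ha : 1 ≤ a) (haN : a ≤ N) {s : List ℤ}
    (h : IsAdmissible s) : Summable (altHead N a s) :=
  Summable.of_norm_bounded summable_one_div_succ_sq fun k => h.abs_altHead_le ha haN k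

theorem IsAdmissible.ne_nil {s : List ℤ} (h : IsAdmissible s) : s ≠ [] := by
  obtain ⟨e, l, rfl, -⟩ := h
  simp

theorem IsAdmissible.summable_altTerm {N a : ℕ} (ha : 1 ≤ a) (haN : a ≤ N) {s : List ℤ}
    (h : IsAdmissible s) : Summable (fun k : StrictDec s.length => altTerm N a s k.1) := by
  refine summable_of_sum_decLists_le zero_le_one s.length (strictDec_iff s.length) (altTerm N a s)
    (∑' k : ℕ, 1 / ((k : ℝ) + 1) ^ 2) fun n => ?_
  have hs : ∀ e ∈ s, e ≠ 0 := by
    obtain ⟨e, l, rfl, he, hl⟩ := h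
    intro x hx
    rcases List.mem_cons.mp hx with rfl | hx
    · omega
    · have := hl x hx
      omega
  have h1 := sum_altTerm N a (s.map abs) h.map_abs.ne_nil n
  rw [List.length_map] at h1
  simp only [abs_altTerm s hs]
  rw [h1]
  refine (sum_le_sum fun k _ => (le_abs_self _).trans (h.map_abs.abs_altHead_le ha haN k)).trans ?_
  exact summable_one_div_succ_sq.sum_le_tsum _ fun k _ => by positivity

theorem IsAdmissible.tAlt_eq {N a : ℕ} (ha : 1 ≤ a) (haN : a ≤ N) {s : List ℤ}
    (h : IsAdmissible s) : tAlt N a s = ∑' k, altHead N a s k := by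
  have h1 := Summable.tendsto_sum_decLists zero_le_one s.length (strictDec_iff s.length)
    (h.summable_altTerm ha haN)
  simp only [sum_altTerm N a s h.ne_nil] at h1
  exact tendsto_nhds_unique h1 (h.summable_altHead ha haN).hasSum.tendsto_sum_nat

/-! ### Interpolated sums -/

theorem natAbs_plus (x y : ℤ) : (plus x y).natAbs = x.natAbs + y.natAbs := by
  have h1 := Int.natCast_natAbs x
  have h2 := Int.natCast_natAbs y
  unfold plus
  rw [← h1, ← h2]
  split_ifs <;> omega

theorem sign_plus {x y : ℤ} (hx : x ≠ 0) (hy : y ≠ 0) :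
    (plus x y).sign = x.sign * y.sign := by
  have h : 0 < |x| + |y| := by positivity
  rw [← Int.sign_mul, plus]
  split_ifs with h1
  · rw [Int.sign_eq_one_of_pos h, Int.sign_eq_one_of_pos h1]
  · have h2 : x * y < 0 := lt_of_le_of_ne (not_lt.mp h1) (mul_ne_zero hx hy)
    rw [Int.sign_eq_neg_one_of_neg h2, Int.sign_neg, Int.sign_eq_one_of_pos h]

theorem altWeight_plus {N a : ℕ} {x y : ℤ} (hx : x ≠ 0) (hy : y ≠ 0) (k : ℕ) :
    altWeight N a (plus x y) k = altWeight N a x k * altWeight N a y k := by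
  rw [altWeight, altWeight, altWeight, natAbs_plus, sign_plus hx hy, pow_add, Int.cast_mul,
    mul_pow, mul_div_mul_comm]

theorem plus_ne_zero {x y : ℤ} (hx : x ≠ 0) : plus x y ≠ 0 := by
  have := natAbs_plus x y
  omega

theorem combine_cons (l : List ℤ) (hl : ∀ x ∈ l, 2 ≤ x.natAbs) (e : ℤ) (c : List Bool) :
    ∃ e' l', combine (e :: l) c = e' :: l' ∧ e.natAbs ≤ e'.natAbs ∧ ∀ x ∈ l', 2 ≤ x.natAbs := by
  induction l generalizing e c with
  | nil => exact ⟨e, [], by simp [combine], le_rfl, by simp⟩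
  | cons y l ih =>
    have hl' : ∀ x ∈ l, 2 ≤ x.natAbs := fun x hx => hl x (List.mem_cons_of_mem _ hx)
    cases c with
    | nil => exact ⟨e, y :: l, by simp [combine], le_rfl, hl⟩
    | cons p c =>
      cases p with
      | true =>
        obtain ⟨e', l', h1, h2, h3⟩ := ih hl' (plus e y) c
        rw [natAbs_plus] at h2
        exact ⟨e', l', by rw [combine, h1], by omega, h3⟩
      | false =>
        obtain ⟨e', l', h1, h2, h3⟩ := ih hl' y c
        refine ⟨e, e' :: l', by rw [combine, h1], le_rfl, fun x hx => ?_⟩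
        rcases List.mem_cons.mp hx with rfl | hx
        · exact (hl y List.mem_cons_self).trans h2
        · exact h3 x hx

theorem isAdmissible_combine {e : ℤ} {l : List ℤ} (he : 4 ≤ e.natAbs)
    (hl : ∀ x ∈ l, 2 ≤ x.natAbs) (c : List Bool) : IsAdmissible (combine (e :: l) c) := by
  obtain ⟨e', l', h1, h2, h3⟩ := combine_cons l hl e c
  exact ⟨e', l', h1, he.trans h2, h3⟩

theorem altSum_eq_sum_altHead (N a : ℕ) {s : List ℤ} (hs : s ≠ []) (k : ℕ) :
    altSum N a s k = ∑ j ∈ range k, altHead N a s j := by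
  cases s with
  | nil => exact absurd rfl hs
  | cons e s => rfl

/-- Summing over the choices of commas and pluses one at a time gives the recursion of
`interpSum`: a plus identifies two variables, a comma makes the second one smaller. -/
theorem sum_combine_altHead (r : ℝ) (N a : ℕ) (l : List ℤ) (hl : ∀ x ∈ l, 2 ≤ x.natAbs) (e : ℤ)
    (he : e ≠ 0) (k : ℕ) :
    ∑ c : Fin l.length → Bool, r ^ (univ.filter (fun i => c i = true)).card *
      altHead N a (combine (e :: l) (List.ofFn c)) k =
        altWeight N a e k * interpSum r N a l k := by
  induction l generalizing e k with
  | nil => simp [combine, altHead, altSum, interpSum]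
  | cons y l ih =>
    have hl' : ∀ x ∈ l, 2 ≤ x.natAbs := fun x hx => hl x (List.mem_cons_of_mem _ hx)
    have hy : y ≠ 0 := by
      have := hl y List.mem_cons_self
      omega
    rw [List.length_cons]
    refine ((Fin.consEquiv (fun _ : Fin (l.length + 1) => Bool)).sum_comp _).symm.trans ?_
    rw [Fintype.sum_prod_type, Fintype.sum_bool]
    have h1 : ∀ c : Fin l.length → Bool,
        r ^ (univ.filter (fun i => (Fin.cons true c : Fin (l.length + 1) → Bool) i = true)).card *
          altHead N a (combine (e :: y :: l)
            (List.ofFn (Fin.cons true c : Fin (l.length + 1) → Bool))) k =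
        r * (r ^ (univ.filter (fun i => c i = true)).card *
          altHead N a (combine (plus e y :: l) (List.ofFn c)) k) := by
      intro c
      rw [Fin.card_filter_univ_succ, List.ofFn_cons, combine]
      simp only [Fin.cons_zero, Fin.cons_succ, if_true, pow_succ]
      ring
    have h2 : ∀ c : Fin l.length → Bool,
        r ^ (univ.filter (fun i => (Fin.cons false c : Fin (l.length + 1) → Bool) i = true)).card *
          altHead N a (combine (e :: y :: l)
            (List.ofFn (Fin.cons false c : Fin (l.length + 1) → Bool))) k =
        altWeight N a e k * ∑ j ∈ range k, (r ^ (univ.filter (fun i => c i = true)).card *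
          altHead N a (combine (y :: l) (List.ofFn c)) j) := by
      intro c
      have hne : combine (y :: l) (List.ofFn c) ≠ [] := by
        obtain ⟨e', l', h, -⟩ := combine_cons l hl' y (List.ofFn c)
        simp [h]
      rw [Fin.card_filter_univ_succ, List.ofFn_cons, combine, altHead,
        altSum_eq_sum_altHead N a hne, ← mul_sum]
      simp only [Fin.cons_zero, Fin.cons_succ, Bool.false_eq_true, if_false]
      ring
    refine (congrArg₂ (· + ·) (sum_congr rfl fun c _ => h1 c)
      (sum_congr rfl fun c _ => h2 c)).trans ?_
    rw [← mul_sum, ← mul_sum, sum_comm, ih hl' _ (plus_ne_zero he), altWeight_plus he hy, interpSum]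
    simp only [ih hl' y hy]
    ring

theorem two_le_natAbs_of_mem_halfTail (d : ℕ) (b : ℕ → ℕ) :
    ∀ x ∈ halfTail d b, 2 ≤ x.natAbs := by
  intro x hx
  rcases List.mem_append.mp hx with hx | hx
  · obtain ⟨i, -, rfl⟩ := List.mem_map.mp hx
    omega
  · rw [List.mem_singleton] at hx
    omega

end LevelT

theorem mainTheorem9 (N a : ℕ) (ha : 1 ≤ a) (haN : a ≤ N) (d : ℕ) (hd : 1 ≤ d)
    (b : ℕ → ℕ) (hb : 1 ≤ b 0) :
    Summable (fun k : LevelT.WeakDec (LevelT.twosThrees d b).length =>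
      LevelT.starTerm N a (LevelT.twosThrees d b) k.1) ∧
    (∀ c : Fin ((LevelT.halfIndex d b).length - 1) → Bool,
      Summable (fun k : LevelT.StrictDec
          (LevelT.combine (LevelT.halfIndex d b) (List.ofFn c)).length =>
        LevelT.altTerm N a (LevelT.combine (LevelT.halfIndex d b) (List.ofFn c)) k.1)) ∧
    LevelT.tStar N a (LevelT.twosThrees d b) =
      2 ^ (d + 1) * (N : ℝ) / ProbabilityTheory.beta ((a : ℝ) / (N : ℝ)) ((a : ℝ) / (N : ℝ)) *
        LevelT.tInterp (1 / 2) N a (LevelT.halfIndex d b) := by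
  open LevelT in
  have hN : 1 ≤ N := ha.trans haN
  have htail := two_le_natAbs_of_mem_halfTail d b
  have hadm : ∀ c : List Bool, IsAdmissible (combine (halfIndex d b) c) := fun c =>
    isAdmissible_combine (by omega) htail c
  set e : ℤ := -(2 * (b 0 : ℤ) + 2) with he
  set f : ℕ → ℝ := fun k => altWeight N a e k * interpSum (1 / 2) N a (halfTail d b) k with hf
  -- The interpolated value is the sum of `f` over the largest variable.
  have hfsum : HasSum f (tInterp (1 / 2) N a (halfIndex d b)) := by
    have h1 : f = fun k => ∑ c : Fin (halfTail d b).length → Bool,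
        (1 / 2 : ℝ) ^ (Finset.univ.filter (fun i => c i = true)).card *
          altHead N a (combine (halfIndex d b) (List.ofFn c)) k := by
      funext k
      exact (sum_combine_altHead (1 / 2) N a _ htail e (by omega) k).symm
    rw [h1]
    refine hasSum_sum fun c _ => HasSum.mul_left _ ?_
    exact ((hadm (List.ofFn c)).tAlt_eq ha haN).symm ▸
      ((hadm (List.ofFn c)).summable_altHead ha haN).hasSum
  have hrep : Represents N a (twosThrees d b) (fun k => 2 ^ (d + 1) * N * f k) := by
    obtain ⟨d, rfl⟩ := Nat.exists_eq_add_of_le' hd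
    convert represents_twosThrees ha hN d b using 2 with k
    have h1 : e.sign = -1 := Int.sign_eq_neg_one_of_neg (by omega)
    have h2 : e.natAbs = 2 * b 0 + 2 := by omega
    simp only [hf, altWeight, h1, h2]
    push_cast
    ring
  have hlim := hrep.tendsto ha hN (hfsum.summable.mul_left _)
  refine ⟨summable_starTerm_of_tendsto hlim, fun c => (hadm _).summable_altTerm ha haN, ?_⟩
  rw [tStar_eq_of_tendsto hlim, tsum_mul_left, hfsum.tsum_eq]
  ring
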